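/- Let $d\ge 1$ and $n\ge d+1$ be integers. Let $X_1,\dots,X_{n+1}$ be independent random points distributed uniformly (normalized spherical Lebesgue measure) on the unit sphere $\mathbb S^d\subset\mathbb R^{d+1}$, let $\rho$ be the geodesic distance on $\mathbb S^d$, and let $$C_i=\{z\in\mathbb S^d:\ \rho(X_i,z)\le\rho(X_j,z)\text{ for all } j\in\{1,\dots,n+1\}\},\qquad i=1,\dots,n+1,$$ be the cells of the spherical Voronoi tessellation generated by these points. Let $N$ be uniformly distributed on $\{1,\dots,n+1\}$ and independent of $(X_1,\dots,X_{n+1})$. For each $v\in\mathbb S^d$ let $O_v$ be an orthogonal transformation of $\mathbb R^{d+1}$ with $O_v v=e:=(1,0,\dots,0)$, whose matrix elements are Borel functions of $v$. The typical cell is the random spherical polytope $\mathscr V_{n+1,d}:=O_{X_N}C_N$. For a spherical polytope $P=C\cap\mathbb S^d$, where $C\subset\mathbb R^{d+1}$ is a polyhedral convex cone (a finite intersection of closed half-spaces whose bounding hyperplanes contain the origin), the $k$-dimensional faces of $P$ are the intersections with $\mathbb S^d$ of the $(k+1)$-dimensional faces of $C$; $f_k(P)$ denotes their number. Let $\tilde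 X_1,\dots,\tilde X_n$ be independent random points in $\mathbb R^d$ with Lebesgue density $$\tilde f_{d,d}(x)=\frac{\Gamma(d)}{\pi^{d/2}\,\Gamma(d/2)}\,(1+\|x\|^2)^{-d},\qquad x\in\mathbb R^d,$$ let $\tilde P^d_{n,d}$ be their convex hull (a beta' polytope), and let $f_k(\tilde P^d_{n,d})$ be the number of its $k$-dimensional faces. Then the random vectors $$\big(f_k(\mathscr V_{n+1,d})\big)_{k=0}^{d-1}\qquad\text{and}\qquad \big(f_{d-k-1}(\tilde P^d_{n,d})\big)_{k=0}^{d-1}$$ have the same distribution. -/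

import Mathlib

open MeasureTheory ProbabilityTheory

noncomputable section

namespace SphericalVoronoi

/-! ### Faces of convex sets and of spherical polytopes -/

/-- The `k`-dimensional faces of a polyhedral set `A`: the nonempty sets of points of `A` at which
some linear functional attains its maximum over `A` (the zero functional gives `A` itself),
whose affine hull has dimension `k`. -/
def faces {E : Type*} [NormedAddCommGroup E] [InnerProductSpace ℝ E] (k : ℕ) (A : Set E) :
    Set (Set E) :=
  {F | F.Nonempty ∧ IsExposed ℝ A F ∧ Module.finrank ℝ (vectorSpan ℝ F) = k}

/-- The number `f_k(A)` of `k`-dimensional faces of a polyhedral set (always finite for those). -/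
def faceCount {E : Type*} [NormedAddCommGroup E] [InnerProductSpace ℝ E] (k : ℕ) (A : Set E) : ℕ :=
  (faces k A).ncard

/-- Polyhedral convex cones: finite intersections of closed half-spaces whose bounding
hyperplanes contain the origin (a zero normal vector imposes no condition, as does `s = ∅`). -/
def IsPolyhedralCone {E : Type*} [NormedAddCommGroup E] [InnerProductSpace ℝ E] (C : Set E) :
    Prop :=
  ∃ s : Finset E, C = {z | ∀ a ∈ s, inner ℝ a z ≤ 0}

/-- The `k`-dimensional faces of a spherical polytope `P = C ∩ 𝕊`, where `C` is a polyhedral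
convex cone and `𝕊` the unit sphere: the intersections with `𝕊` of the `(k+1)`-dimensional faces
of `C`. The cone `C` is determined by `P`. -/
def sphericalFaces {E : Type*} [NormedAddCommGroup E] [InnerProductSpace ℝ E] (k : ℕ)
    (P : Set E) : Set (Set E) :=
  {F | ∃ C : Set E, IsPolyhedralCone C ∧ P = C ∩ Metric.sphere 0 1 ∧
    ∃ G ∈ faces (k + 1) C, F = G ∩ Metric.sphere 0 1}

/-- The number `f_k(P)` of `k`-dimensional faces of a spherical polytope `P`. -/
def sphericalFaceCount {E : Type*} [NormedAddCommGroup E] [InnerProductSpace ℝ E] (k : ℕ)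
    (P : Set E) : ℕ :=
  (sphericalFaces k P).ncard

/-! ### The sphere, Voronoi cells and the typical cell -/

/-- The unit sphere `𝕊^d` in `ℝ^(d+1)`. -/
abbrev UnitSphere (d : ℕ) : Type :=
  Metric.sphere (0 : EuclideanSpace ℝ (Fin (d + 1))) 1

/-- The north pole `e = (1, 0, …, 0)`. -/
def northPole (d : ℕ) : EuclideanSpace ℝ (Fin (d + 1)) :=
  EuclideanSpace.single 0 1

/-- The normalized spherical Lebesgue measure `σ_d` on `𝕊^d`. -/
def sphereUniform (d : ℕ) : Measure (UnitSphere d) :=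
  ((volume : Measure (EuclideanSpace ℝ (Fin (d + 1)))).toSphere Set.univ)⁻¹ •
    (volume : Measure (EuclideanSpace ℝ (Fin (d + 1)))).toSphere

/-- The Voronoi cell of the point `x i` in the spherical Voronoi tessellation generated by
`x 0, …, x (m-1)`. The geodesic distance of two points of the unit sphere is the angle between
them. -/
def voronoiCell {d m : ℕ} (x : Fin m → UnitSphere d) (i : Fin m) :
    Set (EuclideanSpace ℝ (Fin (d + 1))) :=
  {z | z ∈ Metric.sphere (0 : EuclideanSpace ℝ (Fin (d + 1))) 1 ∧
    ∀ j, InnerProductGeometry.angle (x i : EuclideanSpace ℝ (Fin (d + 1))) z ≤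
      InnerProductGeometry.angle (x j : EuclideanSpace ℝ (Fin (d + 1))) z}

/-- The `i`-th Voronoi cell, moved by the orthogonal transformation `O (x i)`. For `O v v = e`,
random `x` and a random uniform index `i` this is the typical cell. -/
def rotatedCell {d m : ℕ}
    (O : UnitSphere d → (EuclideanSpace ℝ (Fin (d + 1)) ≃ₗᵢ[ℝ] EuclideanSpace ℝ (Fin (d + 1))))
    (x : Fin m → UnitSphere d) (i : Fin m) : Set (EuclideanSpace ℝ (Fin (d + 1))) :=
  O (x i) '' voronoiCell x i

/-! ### Beta' distribution -/

/-- The beta' density on `ℝ^d` with parameter `β > d/2`. -/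
def betaPrimeDensity (d : ℕ) (β : ℝ) (x : EuclideanSpace ℝ (Fin d)) : ℝ :=
  Real.Gamma β / (Real.pi ^ ((d : ℝ) / 2) * Real.Gamma (β - (d : ℝ) / 2)) *
    (1 + ‖x‖ ^ 2) ^ (-β)

/-- The beta' distribution on `ℝ^d` with parameter `β > d/2`. -/
def betaPrimeMeasure (d : ℕ) (β : ℝ) : Measure (EuclideanSpace ℝ (Fin d)) :=
  volume.withDensity fun x => ENNReal.ofReal (betaPrimeDensity d β x)

end SphericalVoronoi

end

/-! Rotate the nucleus of the chosen cell to the pole `e` and call the other points `u_j`. The cell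
is then cut from the sphere by the cone `⟨u_j - e, z⟩ ≤ 0`. In the splitting `ℝ × ℝ^d`, with `y_j`
the stereographic projection of `u_j`, the vector `u_j - e` is a positive multiple of `(-1, y_j)`.
So the cone consists of the `(h, w)` with `⟨y_j, w⟩ ≤ h` for all `j`, and a nonempty set of
constraints is exactly the tight set at some `(h, w)` iff it is the set of indices at which a linear
functional is maximal over the `y_j`. Such sets index both the faces of the cone other than the
whole cone and the faces of the hull of the `y_j`. Since `J` spans one dimension more in the cone
picture than its affine dimension in the hull, cone faces of dimension `k + 1` match hull faces of
dimension `d - k - 1` (`faceCount_normalCone_sub_northPole`).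

It remains to find the law of the `y_j`. Given the index and the nucleus, the other points are
i.i.d. uniform, and a rotation followed by stereographic projection sends the uniform law to the
beta' law (`measurePreserving_stereo`), whatever the rotation. This conditional law is constant, so
it is also the unconditional one (`hasLaw_projectOthers`). Coinciding points, where the dictionary
fails, have probability zero. -/

namespace SphericalVoronoi

/-! ### Faces of cones and polytopes through index sets -/

section Faces

variable {ι E : Type*} [NormedAddCommGroup E] [InnerProductSpace ℝ E]

/-- The polyhedral cone with outer normal vectors `a i`. -/
def normalCone (a : ι → E) : Set E :=
  {z | ∀ i, inner ℝ (a i) z ≤ 0}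

/-- `J` is exactly the set of constraints of `normalCone a` that are tight at some point. -/
def IsTightSet (a : ι → E) (J : Set ι) : Prop :=
  ∃ z, ∀ i, inner ℝ (a i) z ≤ 0 ∧ (i ∈ J ↔ inner ℝ (a i) z = 0)

/-- The face of `normalCone a` on which the constraints in `J` are tight. -/
def tightFace (a : ι → E) (J : Set ι) : Set E :=
  {z | z ∈ normalCone a ∧ ∀ i ∈ J, inner ℝ (a i) z = 0}

/-- `J` is the set of indices at which some linear functional attains its maximum over `y`. -/
def IsSupportSet (y : ι → E) (J : Set ι) : Prop :=
  ∃ (l : E) (c : ℝ), ∀ i, inner ℝ (y i) l ≤ c ∧ (i ∈ J ↔ inner ℝ (y i) l = c)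

lemma zero_mem_normalCone (a : ι → E) : (0 : E) ∈ normalCone a := by
  simp [normalCone]

lemma smul_mem_normalCone {a : ι → E} {z : E} (hz : z ∈ normalCone a) {t : ℝ} (ht : 0 ≤ t) :
    t • z ∈ normalCone a := fun i => by
  rw [inner_smul_right]
  exact mul_nonpos_of_nonneg_of_nonpos ht (hz i)

/-- Constraints that are strict at a point survive a small move in any direction; finiteness of `ι`
gives one step size for all of them. -/
lemma exists_pos_forall_add_mul_nonpos [Finite ι] (f g : ι → ℝ) :
    ∃ ε > 0, ∀ i, f i < 0 → f i + ε * g i ≤ 0 := by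
  have h : ∀ i, ∀ᶠ ε in nhdsWithin (0 : ℝ) (Set.Ioi 0), f i < 0 → f i + ε * g i ≤ 0 := by
    intro i
    by_cases hi : f i < 0
    · have hc : Filter.Tendsto (fun ε : ℝ => f i + ε * g i) (nhdsWithin 0 (Set.Ioi 0))
          (nhds (f i + 0 * g i)) :=
        Filter.Tendsto.mono_left (Continuous.tendsto (by fun_prop) 0) nhdsWithin_le_nhds
      filter_upwards [hc.eventually_lt_const (u := 0) (by simpa using hi)] with ε hε _ using hε.le
    · exact Filter.Eventually.of_forall fun ε h => absurd h hi
  obtain ⟨ε, h1, h2⟩ := ((Filter.eventually_all.2 h).and self_mem_nhdsWithin).exists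
  exact ⟨ε, h2, h1⟩

/-- The witness of tightness lies in the face and is strict off `J`, so the face determines `J`. -/
lemma IsTightSet.eq_of_tightFace {a : ι → E} {J : Set ι} (hJ : IsTightSet a J) :
    J = {i | ∀ z ∈ tightFace a J, inner ℝ (a i) z = 0} := by
  obtain ⟨z, hz⟩ := hJ
  ext i
  exact ⟨fun hi w hw => hw.2 i hi, fun h =>
    (hz i).2.2 (h z ⟨fun j => (hz j).1, fun j hj => (hz j).2.1 hj⟩)⟩

/-- The sum of the normals in `J` exposes the face: a sum of nonpositive terms vanishes only if each
term does. -/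
lemma isExposed_tightFace [Finite ι] (a : ι → E) (J : Set ι) :
    IsExposed ℝ (normalCone a) (tightFace a J) := by
  classical
  cases nonempty_fintype ι
  intro _
  refine ⟨innerSL ℝ (∑ i with i ∈ J, a i), ?_⟩
  have key : ∀ z, innerSL ℝ (∑ i with i ∈ J, a i) z = ∑ i with i ∈ J, inner ℝ (a i) z := fun z => by
    simp
  have hle : ∀ z ∈ normalCone a, innerSL ℝ (∑ i with i ∈ J, a i) z ≤ 0 := fun z hz => by
    rw [key]
    exact Finset.sum_nonpos fun i _ => hz i
  ext z
  constructor
  · rintro ⟨hz, hJ⟩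
    refine ⟨hz, fun w hw => (hle w hw).trans_eq ?_⟩
    rw [key]
    exact (Finset.sum_eq_zero fun i hi => hJ i (by simpa using hi)).symm
  · rintro ⟨hz, hmax⟩
    refine ⟨hz, fun i hi => ?_⟩
    have h0 := hmax 0 (zero_mem_normalCone a)
    rw [map_zero] at h0
    have h1 := le_antisymm (hle z hz) h0
    rw [key, Finset.sum_eq_zero_iff_of_nonpos fun i _ => hz i] at h1
    exact h1 i (by simpa using hi)

/-- An exposed face of a cone is cut out by a functional that is nonpositive on the cone. -/
lemma exists_eq_of_isExposed_normalCone {a : ι → E} {F : Set E} (hne : F.Nonempty)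
    (hF : IsExposed ℝ (normalCone a) F) :
    ∃ l : E →L[ℝ] ℝ, (∀ z ∈ normalCone a, l z ≤ 0) ∧ F = {z | z ∈ normalCone a ∧ l z = 0} := by
  obtain ⟨l, rfl⟩ := hF hne
  obtain ⟨x, hx, hmax⟩ := hne
  have h0 : l x = 0 := by
    have h1 := hmax 0 (zero_mem_normalCone a)
    have h2 := hmax _ (smul_mem_normalCone hx zero_le_two)
    rw [map_zero] at h1
    rw [map_smul, smul_eq_mul] at h2
    linarith
  have hle : ∀ z ∈ normalCone a, l z ≤ 0 := fun z hz => h0 ▸ hmax z hz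
  refine ⟨l, hle, ?_⟩
  ext z
  constructor
  · rintro ⟨hz, h⟩
    exact ⟨hz, le_antisymm (hle z hz) (h0 ▸ h x hx)⟩
  · rintro ⟨hz, h⟩
    exact ⟨hz, fun w hw => h.symm ▸ hle w hw⟩

lemma exists_isTightSet_of_isExposed [Finite ι] {a : ι → E} {F : Set E} (hne : F.Nonempty)
    (hF : IsExposed ℝ (normalCone a) F) : ∃ J, IsTightSet a J ∧ F = tightFace a J := by
  classical
  cases nonempty_fintype ι
  obtain ⟨l, hle, rfl⟩ := exists_eq_of_isExposed_normalCone hne hF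
  set F := {z | z ∈ normalCone a ∧ l z = 0} with hFdef
  -- For each constraint not identically tight on `F`, pick a point of `F` where it is strict. The
  -- sum of these points is a relative interior point of `F`.
  have hex : ∀ i, ∃ z ∈ F, (∃ w ∈ F, inner ℝ (a i) w ≠ 0) → inner ℝ (a i) z ≠ 0 := by
    intro i
    by_cases h : ∃ w ∈ F, inner ℝ (a i) w ≠ 0
    · obtain ⟨w, hw, hw'⟩ := h
      exact ⟨w, hw, fun _ => hw'⟩
    · obtain ⟨w, hw⟩ := hne
      exact ⟨w, hw, fun h' => absurd h' h⟩
  choose p hpF hp using hex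
  have hz : ∀ i, inner ℝ (a i) (∑ j, p j) = ∑ j, inner ℝ (a i) (p j) := fun i => inner_sum _ _ _
  have hzC : ∑ j, p j ∈ normalCone a := fun i => by
    rw [hz]
    exact Finset.sum_nonpos fun j _ => (hpF j).1 i
  have hlz : l (∑ j, p j) = 0 := by
    rw [map_sum]
    exact Finset.sum_eq_zero fun j _ => (hpF j).2
  refine ⟨{i | ∀ w ∈ F, inner ℝ (a i) w = 0}, ⟨∑ j, p j, fun i => ⟨hzC i, ?_, ?_⟩⟩, ?_⟩
  · exact fun hi => hi _ ⟨hzC, hlz⟩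
  · intro hi
    by_contra hcon
    have hcon' : ∃ w ∈ F, inner ℝ (a i) w ≠ 0 := by simpa using hcon
    rw [hz, Finset.sum_eq_zero_iff_of_nonpos fun j _ => (hpF j).1 i] at hi
    exact hp i hcon' (hi i (Finset.mem_univ i))
  · ext w
    refine ⟨fun hw => ⟨hw.1, fun i hi => hi w hw⟩, fun hw => ⟨hw.1, le_antisymm (hle w hw.1) ?_⟩⟩
    -- Stepping from the relative interior point along `-w` stays in the cone, so `l ≤ 0` there
    -- forces `l w ≥ 0`.
    obtain ⟨ε, hε, h⟩ := exists_pos_forall_add_mul_nonpos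
      (fun i => inner ℝ (a i) (∑ j, p j)) (fun i => -inner ℝ (a i) w)
    have hmem : ∑ j, p j + ε • (-w) ∈ normalCone a := by
      intro i
      rw [inner_add_right, inner_smul_right, inner_neg_right]
      rcases (hzC i).lt_or_eq with hlt | heq
      · exact h i hlt
      · have hi : ∀ v ∈ F, inner ℝ (a i) v = 0 := by
          by_contra hcon
          have hcon' : ∃ w ∈ F, inner ℝ (a i) w ≠ 0 := by simpa using hcon
          rw [hz, Finset.sum_eq_zero_iff_of_nonpos fun j _ => (hpF j).1 i] at heq
          exact hp i hcon' (heq i (Finset.mem_univ i))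
        rw [heq, hw.2 i hi]
        simp
    have h3 := hle _ hmem
    rw [map_add, hlz, map_smul, map_neg, smul_eq_mul, zero_add, mul_neg] at h3
    nlinarith

/-- From a point strict off `J`, every direction orthogonal to the normals in `J` can be followed a
short way inside the face. -/
lemma vectorSpan_tightFace [Finite ι] {a : ι → E} {J : Set ι} (hJ : IsTightSet a J) :
    vectorSpan ℝ (tightFace a J) = (Submodule.span ℝ (a '' J))ᗮ := by
  obtain ⟨z, hz⟩ := hJ
  have hzF : z ∈ tightFace a J := ⟨fun i => (hz i).1, fun i hi => (hz i).2.1 hi⟩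
  apply le_antisymm
  · rw [vectorSpan_def, Submodule.span_le]
    rintro _ ⟨u, hu, v, hv, rfl⟩
    simp only [SetLike.mem_coe, Submodule.mem_orthogonal]
    intro x hx
    induction hx using Submodule.span_induction with
    | mem x hx =>
      obtain ⟨i, hi, rfl⟩ := hx
      simp [vsub_eq_sub, inner_sub_right, hu.2 i hi, hv.2 i hi]
    | zero => simp
    | add x y _ _ hx hy => rw [inner_add_left, hx, hy, add_zero]
    | smul c x _ hx => rw [inner_smul_left, hx, mul_zero]
  · intro w hw
    have hw' : ∀ i ∈ J, inner ℝ (a i) w = 0 := fun i hi =>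
      hw _ (Submodule.subset_span ⟨i, hi, rfl⟩)
    obtain ⟨ε, hε, h⟩ := exists_pos_forall_add_mul_nonpos
      (fun i => inner ℝ (a i) z) (fun i => inner ℝ (a i) w)
    have hmem : z + ε • w ∈ tightFace a J := by
      refine ⟨fun i => ?_, fun i hi => ?_⟩
      · rw [inner_add_right, inner_smul_right]
        by_cases hi : i ∈ J
        · simp [(hz i).2.1 hi, hw' i hi]
        · exact h i (lt_of_le_of_ne (hz i).1 fun he => hi ((hz i).2.2 he))
      · rw [inner_add_right, inner_smul_right, (hz i).2.1 hi, hw' i hi, mul_zero, add_zero]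
    have := vsub_mem_vectorSpan ℝ hmem hzF
    rw [vsub_eq_sub, add_sub_cancel_left] at this
    simpa [smul_smul, hε.ne'] using Submodule.smul_mem _ ε⁻¹ this

/-- Faces of a polyhedral cone correspond to its tight sets of constraints. -/
theorem faceCount_normalCone [Finite ι] (a : ι → E) (m : ℕ) :
    faceCount m (normalCone a) =
      {J | IsTightSet a J ∧ Module.finrank ℝ (Submodule.span ℝ (a '' J))ᗮ = m}.ncard := by
  symm
  refine Set.ncard_congr (fun J _ => tightFace a J) ?_ ?_ ?_
  · rintro J ⟨hJ, hm⟩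
    refine ⟨?_, isExposed_tightFace a J, by rw [vectorSpan_tightFace hJ, hm]⟩
    exact ⟨0, zero_mem_normalCone a, by simp⟩
  · rintro J K ⟨hJ, -⟩ ⟨hK, -⟩ h
    rw [hJ.eq_of_tightFace, hK.eq_of_tightFace]
    exact congrArg (fun F : Set E => {i | ∀ z ∈ F, inner ℝ (a i) z = 0}) h
  · rintro F ⟨hne, hF, hm⟩
    obtain ⟨J, hJ, rfl⟩ := exists_isTightSet_of_isExposed hne hF
    exact ⟨J, ⟨hJ, by rw [← vectorSpan_tightFace hJ, hm]⟩, rfl⟩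

/-- The points of a convex hull at which a functional attains its maximum. -/
lemma setOf_mem_convexHull_and_eq {y : ι → E} {l : E →L[ℝ] ℝ} {c : ℝ} (hle : ∀ i, l (y i) ≤ c) :
    {x | x ∈ convexHull ℝ (Set.range y) ∧ l x = c} = convexHull ℝ (y '' {i | l (y i) = c}) := by
  apply Set.Subset.antisymm
  · rintro x ⟨hx, hxc⟩
    set K := convexHull ℝ (y '' {i | l (y i) = c})
    have hK : ∀ z ∈ K, l z = c := fun z hz =>
      convexHull_min (t := {z | l z = c}) (by rintro _ ⟨i, hi, rfl⟩; exact hi)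
        (convex_hyperplane l.toLinearMap.isLinear c) hz
    -- A proper convex combination reaches level `c` only if both endpoints do. So this union is
    -- convex, and as it contains all `y i` it contains their hull.
    have hconv : Convex ℝ (K ∪ {z | l z < c}) := by
      rintro u hu v hv s t hs ht hst
      by_cases hboth : u ∈ K ∧ v ∈ K
      · exact Or.inl (convex_convexHull ℝ _ hboth.1 hboth.2 hs ht hst)
      · have hu' : l u ≤ c := hu.elim (fun h => (hK u h).le) fun h => le_of_lt h
        have hv' : l v ≤ c := hv.elim (fun h => (hK v h).le) fun h => le_of_lt h
        rcases hs.eq_or_lt with rfl | hs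
        · simp only [zero_add] at hst
          simpa [hst] using hv
        rcases ht.eq_or_lt with rfl | ht
        · simp only [add_zero] at hst
          simpa [hst] using hu
        right
        have : t = 1 - s := by linarith
        subst this
        simp only [Set.mem_ofPred_eq, map_add, map_smul, smul_eq_mul]
        rcases not_and_or.1 hboth with h | h
        · have : l u < c := hu.resolve_left h
          nlinarith
        · have : l v < c := hv.resolve_left h
          nlinarith
    have hsub : Set.range y ⊆ K ∪ {z | l z < c} := by
      rintro _ ⟨i, rfl⟩
      rcases (hle i).lt_or_eq with h | h
      · exact Or.inr h
      · exact Or.inl (subset_convexHull ℝ _ ⟨i, h, rfl⟩)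
    exact (convexHull_min hsub hconv hx).resolve_right (by simp [hxc])
  · exact convexHull_min (t := {x | x ∈ convexHull ℝ (Set.range y) ∧ l x = c})
      (by rintro _ ⟨i, hi, rfl⟩; exact ⟨subset_convexHull ℝ _ ⟨i, rfl⟩, hi⟩)
      ((convex_convexHull ℝ _).inter (convex_hyperplane l.toLinearMap.isLinear c))

lemma vectorSpan_convexHull (s : Set E) : vectorSpan ℝ (convexHull ℝ s) = vectorSpan ℝ s := by
  rw [← direction_affineSpan, affineSpan_convexHull, direction_affineSpan]

/-- Faces of a convex hull correspond to the sets of indices supporting it. -/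
theorem faceCount_convexHull_range [CompleteSpace E] (y : ι → E) (m : ℕ) :
    faceCount m (convexHull ℝ (Set.range y)) =
      {J : Set ι | (J.Nonempty ∧ IsSupportSet y J) ∧
        Module.finrank ℝ (vectorSpan ℝ (y '' J)) = m}.ncard := by
  symm
  have hface : ∀ {J : Set ι} {l : E} {c : ℝ},
      (∀ i, inner ℝ (y i) l ≤ c ∧ (i ∈ J ↔ inner ℝ (y i) l = c)) →
      {x | x ∈ convexHull ℝ (Set.range y) ∧ innerSL ℝ l x = c} = convexHull ℝ (y '' J) := by
    intro J l c h
    have hJ : J = {i | innerSL ℝ l (y i) = c} := by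
      ext i
      simpa [real_inner_comm] using (h i).2
    rw [setOf_mem_convexHull_and_eq fun i => by simpa [real_inner_comm] using (h i).1, ← hJ]
  refine Set.ncard_congr (fun J _ => convexHull ℝ (y '' J)) ?_ ?_ ?_
  · rintro J ⟨⟨⟨i, hi⟩, l, c, h⟩, hm⟩
    refine ⟨⟨y i, subset_convexHull ℝ _ ⟨i, hi, rfl⟩⟩, fun _ => ⟨innerSL ℝ l, ?_⟩,
      by rw [vectorSpan_convexHull, hm]⟩
    rw [← hface h]
    have hle : ∀ x ∈ convexHull ℝ (Set.range y), innerSL ℝ l x ≤ c := fun x hx =>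
      convexHull_min (t := {x | innerSL ℝ l x ≤ c})
        (by rintro _ ⟨j, rfl⟩; simpa [real_inner_comm] using (h j).1)
        (convex_halfSpace_le (innerSL ℝ l).toLinearMap.isLinear c) hx
    ext x
    constructor
    · rintro ⟨hx, hxc⟩
      exact ⟨hx, fun w hw => (hle w hw).trans_eq hxc.symm⟩
    · rintro ⟨hx, hmax⟩
      refine ⟨hx, le_antisymm (hle x hx) ?_⟩
      have h1 := hmax (y i) (subset_convexHull ℝ _ ⟨i, rfl⟩)
      have h2 : innerSL ℝ l (y i) = c := by simpa [real_inner_comm] using (h i).2.1 hi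
      rwa [h2] at h1
  · rintro J K ⟨⟨-, l, c, h⟩, -⟩ ⟨⟨-, l', c', h'⟩, -⟩ hJK
    have key : ∀ {J : Set ι} {l : E} {c : ℝ},
        (∀ i, inner ℝ (y i) l ≤ c ∧ (i ∈ J ↔ inner ℝ (y i) l = c)) →
        J = {i | y i ∈ convexHull ℝ (y '' J)} := by
      intro J l c h
      ext i
      rw [← hface h]
      refine ⟨fun hi => ⟨subset_convexHull ℝ _ ⟨i, rfl⟩, ?_⟩, fun hi => ?_⟩
      · simpa [real_inner_comm] using (h i).2.1 hi
      · exact (h i).2.2 (by simpa [real_inner_comm] using hi.2)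
    rw [key h, key h']
    exact congrArg (fun F : Set E => {i | y i ∈ F}) hJK
  · rintro F ⟨hne, hF, hm⟩
    obtain ⟨l, rfl⟩ := hF hne
    obtain ⟨x, hx, hmax⟩ := hne
    have hc : ∀ i, inner ℝ (y i) ((InnerProductSpace.toDual ℝ E).symm l) = l (y i) := fun i => by
      rw [real_inner_comm, InnerProductSpace.toDual_symm_apply]
    have hle : ∀ i, l (y i) ≤ l x := fun i => hmax _ (subset_convexHull ℝ _ ⟨i, rfl⟩)
    have hFeq : {z | z ∈ convexHull ℝ (Set.range y) ∧ ∀ w ∈ convexHull ℝ (Set.range y), l w ≤ l z} =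
        convexHull ℝ (y '' {i | l (y i) = l x}) := by
      rw [← setOf_mem_convexHull_and_eq hle]
      ext z
      constructor
      · rintro ⟨hz, h⟩
        exact ⟨hz, le_antisymm (hmax z hz) (h x hx)⟩
      · rintro ⟨hz, h⟩
        exact ⟨hz, fun w hw => h ▸ hmax w hw⟩
    have hxF : x ∈ convexHull ℝ (y '' {i | l (y i) = l x}) := by
      rw [← hFeq]
      exact ⟨hx, hmax⟩
    refine ⟨{i | l (y i) = l x},
      ⟨⟨?_, (InnerProductSpace.toDual ℝ E).symm l, l x, ?_⟩, ?_⟩, hFeq.symm⟩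
    · exact Set.image_nonempty.1 (convexHull_nonempty_iff.1 ⟨x, hxF⟩)
    · intro i
      rw [hc]
      exact ⟨hle i, Iff.rfl⟩
    · rw [← vectorSpan_convexHull, ← hFeq]
      exact hm

lemma isPolyhedralCone_normalCone [Finite ι] (a : ι → E) : IsPolyhedralCone (normalCone a) := by
  classical
  cases nonempty_fintype ι
  exact ⟨Finset.univ.image a, by simp [normalCone]⟩

lemma IsPolyhedralCone.smul_mem_iff {C : Set E} (hC : IsPolyhedralCone C) {t : ℝ} (ht : 0 < t)
    (z : E) : t • z ∈ C ↔ z ∈ C := by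
  obtain ⟨s, rfl⟩ := hC
  simp only [Set.mem_ofPred_eq, inner_smul_right]
  refine forall₂_congr fun a _ => ?_
  exact mul_nonpos_iff_pos_imp_nonpos.trans ⟨fun h => h.1 ht, fun h => ⟨fun _ => h, fun _ => ht.le⟩⟩

/-- A set containing zero and closed under positive scalings is determined by its unit vectors. -/
lemma eq_of_inter_sphere_eq {C D : Set E} (h0C : (0 : E) ∈ C) (h0D : (0 : E) ∈ D)
    (hC : ∀ {t : ℝ}, 0 < t → ∀ z, t • z ∈ C ↔ z ∈ C) (hD : ∀ {t : ℝ}, 0 < t → ∀ z, t • z ∈ D ↔ z ∈ D)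
    (h : C ∩ Metric.sphere 0 1 = D ∩ Metric.sphere 0 1) : C = D := by
  ext z
  by_cases hz : z = 0
  · simp [hz, h0C, h0D]
  · have hpos : 0 < ‖z‖⁻¹ := by positivity
    have hs : ‖z‖⁻¹ • z ∈ Metric.sphere (0 : E) 1 := by simp [norm_smul, hz]
    have := Set.ext_iff.1 h (‖z‖⁻¹ • z)
    simp only [Set.mem_inter_iff, hs, and_true] at this
    rwa [hC hpos, hD hpos] at this

/-- Cones and their exposed faces contain `0` and are invariant under positive scaling, so their
traces on the sphere determine them. This makes the existentially quantified cone unique and `G ↦ G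
∩ 𝕊` injective. -/
theorem sphericalFaceCount_normalCone [Finite ι] (a : ι → E) (k : ℕ) :
    sphericalFaceCount k (normalCone a ∩ Metric.sphere 0 1) = faceCount (k + 1) (normalCone a) := by
  have hfaces : sphericalFaces k (normalCone a ∩ Metric.sphere 0 1) =
      (fun G => G ∩ Metric.sphere 0 1) '' faces (k + 1) (normalCone a) := by
    ext F
    constructor
    · rintro ⟨C, hC, hCeq, G, hG, rfl⟩
      have h0 : (0 : E) ∈ C := by
        obtain ⟨s, rfl⟩ := hC
        simp
      have : C = normalCone a := eq_of_inter_sphere_eq h0 (zero_mem_normalCone a)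
        hC.smul_mem_iff (isPolyhedralCone_normalCone a).smul_mem_iff hCeq.symm
      exact ⟨G, this ▸ hG, rfl⟩
    · rintro ⟨G, hG, rfl⟩
      exact ⟨normalCone a, isPolyhedralCone_normalCone a, rfl, G, hG, rfl⟩
  rw [sphericalFaceCount, hfaces, faceCount]
  apply Set.InjOn.ncard_image
  have hG : ∀ G ∈ faces (k + 1) (normalCone a),
      (0 : E) ∈ G ∧ ∀ {t : ℝ}, 0 < t → ∀ z, t • z ∈ G ↔ z ∈ G := by
    rintro G ⟨hne, hG, -⟩
    obtain ⟨l, -, rfl⟩ := exists_eq_of_isExposed_normalCone hne hG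
    refine ⟨⟨zero_mem_normalCone a, map_zero l⟩, fun {t} ht z => ?_⟩
    simp [(isPolyhedralCone_normalCone a).smul_mem_iff ht, ht.ne']
  intro G hG' H hH' h
  exact eq_of_inter_sphere_eq (hG G hG').1 (hG H hH').1 (hG G hG').2 (hG H hH').2 h

end Faces

end SphericalVoronoi

noncomputable section

namespace SphericalVoronoi

/-! ### Measurability of the face numbers of a random polytope -/

section Measurability

variable {ι E : Type*} [NormedAddCommGroup E] [InnerProductSpace ℝ E]

lemma _root_.IsSigmaCompact.measurableSet_of_t2 {α : Type*} [TopologicalSpace α] [T2Space α]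
    [MeasurableSpace α] [BorelSpace α] {s : Set α} (hs : IsSigmaCompact s) : MeasurableSet s := by
  obtain ⟨K, hK, rfl⟩ := hs
  exact MeasurableSet.iUnion fun n => (hK n).isClosed.measurableSet

/-- By scaling the functional, the strict inequalities may be given a gap. -/
lemma isSupportSet_iff_exists_gap [Finite ι] (y : ι → E) (J : Set ι) :
    IsSupportSet y J ↔ ∃ p : E × ℝ,
      (∀ i ∈ J, inner ℝ (y i) p.1 = p.2) ∧ ∀ i ∉ J, inner ℝ (y i) p.1 ≤ p.2 - 1 := by
  cases nonempty_fintype ι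
  constructor
  · rintro ⟨l, c, h⟩
    have hpos : ∀ i ∉ J, 0 < c - inner ℝ (y i) l := fun i hi =>
      sub_pos.2 (lt_of_le_of_ne (h i).1 fun he => hi ((h i).2.2 he))
    -- `t` dominates the reciprocal of every positive slack, so scaling by `t` makes these slacks at
    -- least `1`.
    set t := ∑ i, |(c - inner ℝ (y i) l)⁻¹| with ht
    refine ⟨(t • l, t * c), fun i hi => ?_, fun i hi => ?_⟩
    · rw [inner_smul_right, (h i).2.1 hi]
    · rw [inner_smul_right]
      have h1 : (c - inner ℝ (y i) l)⁻¹ ≤ t := (le_abs_self _).trans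
        (Finset.single_le_sum (f := fun i => |(c - inner ℝ (y i) l)⁻¹|)
          (fun _ _ => abs_nonneg _) (Finset.mem_univ i))
      have h2 := mul_le_mul_of_nonneg_right h1 (hpos i hi).le
      rw [inv_mul_cancel₀ (hpos i hi).ne'] at h2
      simp only
      linarith
  · rintro ⟨⟨l, c⟩, h1, h2⟩
    refine ⟨l, c, fun i => ?_⟩
    by_cases hi : i ∈ J
    · exact ⟨(h1 i hi).le, fun _ => h1 i hi, fun _ => hi⟩
    · have := h2 i hi
      simp only at this
      exact ⟨by linarith, fun h => absurd h hi, fun h => by linarith⟩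

/-- Turns a rank bound into a finite union of linear independence conditions, each of them open. -/
lemma le_finrank_span_range_iff [FiniteDimensional ℝ E] {κ : Type*} [Finite κ] (v : κ → E) (m : ℕ) :
    m ≤ Module.finrank ℝ (Submodule.span ℝ (Set.range v)) ↔
      ∃ f : Fin m → κ, LinearIndependent ℝ fun j => v (f j) := by
  constructor
  · intro h
    obtain ⟨κ', a, -, hspan, hli⟩ := exists_linearIndependent' ℝ v
    have : Finite κ' := hli.finite
    cases nonempty_fintype κ'
    rw [← hspan, finrank_span_eq_card hli] at h
    obtain ⟨g⟩ : Nonempty (Fin m ↪ κ') :=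
      Function.Embedding.nonempty_of_card_le (by simpa using h)
    exact ⟨fun j => a (g j), hli.comp g g.injective⟩
  · rintro ⟨f, hf⟩
    have h1 := finrank_span_eq_card hf
    rw [Fintype.card_fin] at h1
    conv_lhs => rw [← h1]
    refine Submodule.finrank_mono (Submodule.span_mono ?_)
    rintro _ ⟨j, rfl⟩
    exact ⟨f j, rfl⟩

variable [Finite ι] [FiniteDimensional ℝ E] [MeasurableSpace E] [BorelSpace E]

/-- The gap makes the set of pairs (points, functional) closed, hence σ-compact, and a continuous
projection of a σ-compact set is again σ-compact, thus Borel. -/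
lemma measurableSet_isSupportSet (J : Set ι) : MeasurableSet {y : ι → E | IsSupportSet y J} := by
  cases nonempty_fintype ι
  set K := {q : (ι → E) × (E × ℝ) |
    (∀ i ∈ J, inner ℝ (q.1 i) q.2.1 = q.2.2) ∧ ∀ i ∉ J, inner ℝ (q.1 i) q.2.1 ≤ q.2.2 - 1}
  have hK : IsClosed K := by
    simp only [K, Set.ofPred_and, Set.ofPred_forall]
    refine (isClosed_iInter fun i => isClosed_iInter fun _ => ?_).inter
      (isClosed_iInter fun i => isClosed_iInter fun _ => ?_)
    · exact isClosed_eq (by fun_prop) (by fun_prop)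
    · exact isClosed_le (by fun_prop) (by fun_prop)
  have : {y : ι → E | IsSupportSet y J} = Prod.fst '' K := by
    ext y
    simp [isSupportSet_iff_exists_gap, K]
  rw [this]
  exact ((isSigmaCompact_univ.of_isClosed_subset hK (Set.subset_univ K)).image
    continuous_fst).measurableSet_of_t2

lemma measurable_finrank_vectorSpan_image {J : Set ι} (hJ : J.Nonempty) :
    Measurable fun y : ι → E => Module.finrank ℝ (vectorSpan ℝ (y '' J)) := by
  cases nonempty_fintype ι
  obtain ⟨i₀, hi₀⟩ := hJ
  refine measurable_of_Ici fun m => ?_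
  have : (fun y : ι → E => Module.finrank ℝ (vectorSpan ℝ (y '' J))) ⁻¹' Set.Ici m =
      ⋃ f : Fin m → J, (fun (y : ι → E) j => y (f j) - y i₀) ⁻¹'
        {v : Fin m → E | LinearIndependent ℝ v} := by
    ext y
    have hspan : vectorSpan ℝ (y '' J) =
        Submodule.span ℝ (Set.range fun i : J => y i - y i₀) := by
      have := vectorSpan_range_eq_span_range_vsub_right ℝ (fun i : J => y i) ⟨i₀, hi₀⟩
      rw [Set.image_eq_range]
      exact this
    rw [Set.mem_preimage, Set.mem_Ici, hspan, le_finrank_span_range_iff (fun i : J => y i - y i₀) m,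
      Set.mem_iUnion]
    rfl
  rw [this]
  refine MeasurableSet.iUnion fun f => IsOpen.measurableSet ?_
  exact isOpen_setOfPred_linearIndependent.preimage (by fun_prop)

theorem measurable_faceCount_convexHull_range (m : ℕ) :
    Measurable fun y : ι → E => faceCount m (convexHull ℝ (Set.range y)) := by
  classical
  cases nonempty_fintype ι
  have : (fun y : ι → E => faceCount m (convexHull ℝ (Set.range y))) = fun y => ∑ J : Set ι,
      {y : ι → E | (J.Nonempty ∧ IsSupportSet y J) ∧
        Module.finrank ℝ (vectorSpan ℝ (y '' J)) = m}.indicator (fun _ => 1) y := by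
    funext y
    rw [faceCount_convexHull_range, Set.ncard_eq_toFinset_card', Finset.card_eq_sum_ones,
      Set.toFinset_ofPred, Finset.sum_filter]
    simp only [Set.indicator_apply, Set.mem_ofPred_eq]
  rw [this]
  refine Finset.measurable_sum _ fun J _ => measurable_const.indicator ?_
  by_cases hJ : J.Nonempty
  · simp only [hJ, true_and, Set.ofPred_and]
    exact (measurableSet_isSupportSet J).inter
      (measurable_finrank_vectorSpan_image hJ (measurableSet_singleton m))
  · simp [hJ]

end Measurability

/-! ### Splitting off the first coordinate, and the stereographic projection -/

/-- The identification of `ℝ^(d+1)` with `ℝ × ℝ^d` given by the first coordinate. -/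
def splitFirst (d : ℕ) :
    EuclideanSpace ℝ (Fin (d + 1)) ≃ₗᵢ[ℝ] WithLp 2 (ℝ × EuclideanSpace ℝ (Fin d)) where
  toFun x := WithLp.toLp 2 (x 0, WithLp.toLp 2 fun i => x i.succ)
  invFun p := WithLp.toLp 2 (Fin.cons p.fst p.snd.ofLp)
  map_add' x y := rfl
  map_smul' c x := rfl
  left_inv x := by
    ext i
    refine Fin.cases ?_ (fun j => ?_) i <;> simp
  right_inv p := by
    apply (WithLp.equiv 2 _).injective
    ext <;> simp
  norm_map' x := by
    rw [← sq_eq_sq₀ (norm_nonneg _) (norm_nonneg _)]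
    rw [EuclideanSpace.norm_sq_eq, Fin.sum_univ_succ, WithLp.prod_norm_sq_eq_of_L2,
      EuclideanSpace.norm_sq_eq (x := (WithLp.snd _))]
    rfl

/-- The first coordinate of a vector. -/
abbrev height {d : ℕ} (x : EuclideanSpace ℝ (Fin (d + 1))) : ℝ := (splitFirst d x).fst

/-- The vector of the remaining coordinates. -/
abbrev tail {d : ℕ} (x : EuclideanSpace ℝ (Fin (d + 1))) : EuclideanSpace ℝ (Fin d) :=
  (splitFirst d x).snd

/-- The stereographic projection from the north pole. -/
def stereo {d : ℕ} (x : EuclideanSpace ℝ (Fin (d + 1))) : EuclideanSpace ℝ (Fin d) :=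
  (1 - height x)⁻¹ • tail x

lemma inner_eq_height_mul_add {d : ℕ} (x z : EuclideanSpace ℝ (Fin (d + 1))) :
    inner ℝ x z = height x * height z + inner ℝ (tail x) (tail z) := by
  rw [← (splitFirst d).inner_map_map, WithLp.prod_inner_apply]
  simp [mul_comm]

lemma splitFirst_northPole (d : ℕ) : splitFirst d (northPole d) = WithLp.toLp 2 (1, 0) := by
  apply (WithLp.equiv 2 _).injective
  refine Prod.ext ?_ ?_
  · change (northPole d) 0 = 1
    simp [northPole]
  · ext i
    change (northPole d) i.succ = 0
    simp [northPole]

lemma norm_sq_eq_height_sq_add {d : ℕ} (x : EuclideanSpace ℝ (Fin (d + 1))) :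
    ‖x‖ ^ 2 = height x ^ 2 + ‖tail x‖ ^ 2 := by
  rw [← real_inner_self_eq_norm_sq, inner_eq_height_mul_add, real_inner_self_eq_norm_sq, sq (height x)]

lemma height_lt_one {d : ℕ} {x : EuclideanSpace ℝ (Fin (d + 1))} (hx : ‖x‖ = 1)
    (hne : x ≠ northPole d) : height x < 1 := by
  have h := norm_sq_eq_height_sq_add x
  rw [hx] at h
  have h2 := sq_nonneg ‖tail x‖
  refine lt_of_le_of_ne (by nlinarith) fun h1 => hne ?_
  apply (splitFirst d).injective
  rw [splitFirst_northPole]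
  rw [h1] at h
  have h3 : tail x = 0 := by
    have : ‖tail x‖ ^ 2 = 0 := by linarith
    simpa using this
  apply (WithLp.equiv 2 _).injective
  exact Prod.ext h1 h3

/-! ### The cell of the north pole and the hull of the projected points -/

section Duality

variable {ι : Type*} {d : ℕ}

/-- The key identity: `u - e` is `1 - height u` times `(-1, stereo u)`. -/
lemma inner_sub_northPole {u : EuclideanSpace ℝ (Fin (d + 1))} (hu : height u < 1)
    (z : EuclideanSpace ℝ (Fin (d + 1))) :
    inner ℝ (u - northPole d) z = (1 - height u) * (inner ℝ (stereo u) (tail z) - height z) := by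
  have h : 1 - height u ≠ 0 := by linarith
  rw [inner_sub_left, inner_eq_height_mul_add, inner_eq_height_mul_add, stereo, inner_smul_left]
  simp only [height, tail, splitFirst_northPole] at h ⊢
  simp
  field_simp
  ring

/-- A point `z` of the cone is read as the functional `tail z` with bound `height z`, and
conversely. -/
lemma isTightSet_sub_northPole_iff {u : ι → EuclideanSpace ℝ (Fin (d + 1))}
    (hu : ∀ i, height (u i) < 1) (J : Set ι) :
    IsTightSet (fun i => u i - northPole d) J ↔ IsSupportSet (fun i => stereo (u i)) J := by
  have h1 : ∀ i z, inner ℝ (u i - northPole d) z ≤ 0 ↔ inner ℝ (stereo (u i)) (tail z) ≤ height z :=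
    fun i z => by
      have := hu i
      rw [inner_sub_northPole (hu i), mul_nonpos_iff_pos_imp_nonpos]
      constructor
      · intro h
        linarith [h.1 (by linarith)]
      · exact fun h => ⟨fun _ => by linarith, fun _ => by linarith⟩
  have h2 : ∀ i z, inner ℝ (u i - northPole d) z = 0 ↔ inner ℝ (stereo (u i)) (tail z) = height z :=
    fun i z => by
      have : 1 - height (u i) ≠ 0 := by linarith [hu i]
      rw [inner_sub_northPole (hu i), mul_eq_zero, or_iff_right this, sub_eq_zero]
  simp only [IsTightSet, IsSupportSet, h1, h2]
  constructor
  · rintro ⟨z, hz⟩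
    exact ⟨tail z, height z, hz⟩
  · rintro ⟨l, c, h⟩
    exact ⟨(splitFirst d).symm (WithLp.toLp 2 (c, l)), by simpa [tail, height] using h⟩

/-- Up to positive factors the vectors are `(-1, y i)`. Their span is the horizontal span of the
differences plus one line off the horizontal hyperplane. -/
lemma finrank_span_sub_northPole {u : ι → EuclideanSpace ℝ (Fin (d + 1))}
    (hu : ∀ i, height (u i) < 1) {J : Set ι} (hJ : J.Nonempty) :
    Module.finrank ℝ (Submodule.span ℝ ((fun i => u i - northPole d) '' J)) =
      Module.finrank ℝ (vectorSpan ℝ ((fun i => stereo (u i)) '' J)) + 1 := by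
  obtain ⟨i₀, hi₀⟩ := hJ
  set a := fun i => u i - northPole d
  set y := fun i => stereo (u i)
  -- the embedding of `ℝ^d` as a horizontal hyperplane, and its translate through `(-1, 0)`
  let emb : EuclideanSpace ℝ (Fin d) →ₗ[ℝ] EuclideanSpace ℝ (Fin (d + 1)) :=
    (splitFirst d).symm.toLinearEquiv.toLinearMap ∘ₗ
      (WithLp.linearEquiv 2 ℝ (ℝ × EuclideanSpace ℝ (Fin d))).symm.toLinearMap ∘ₗ
        LinearMap.inr ℝ ℝ (EuclideanSpace ℝ (Fin d))
  have hemb : Function.Injective emb := by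
    simp only [emb, LinearMap.coe_comp]
    exact (splitFirst d).symm.injective.comp
      ((WithLp.linearEquiv 2 ℝ _).symm.injective.comp LinearMap.inr_injective)
  have hheight : ∀ w, height (emb w) = 0 := fun w => by simp [emb, height]
  have ha : ∀ i, a i = (1 - height (u i)) • (emb (y i) - northPole d) := fun i => by
    have h : 1 - height (u i) ≠ 0 := by linarith [hu i]
    apply (splitFirst d).injective
    rw [map_smul, map_sub, map_sub, splitFirst_northPole]
    apply (WithLp.equiv 2 _).injective
    refine Prod.ext ?_ ?_
    · simp [emb, height]
    · simp only [height] at h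
      simp [emb, y, stereo, smul_smul, height, tail, h]
  have hspan : Submodule.span ℝ (a '' J) =
      (vectorSpan ℝ (y '' J)).map emb ⊔ Submodule.span ℝ {a i₀} := by
    have hp : ∀ i ∈ J, emb (y i) - northPole d ∈ Submodule.span ℝ (a '' J) := fun i hi => by
      have h : 1 - height (u i) ≠ 0 := by linarith [hu i]
      have := Submodule.smul_mem _ (1 - height (u i))⁻¹
        (Submodule.subset_span (R := ℝ) (Set.mem_image_of_mem a hi))
      rwa [ha, smul_smul, inv_mul_cancel₀ h, one_smul] at this
    apply le_antisymm
    · rw [Submodule.span_le]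
      rintro _ ⟨i, hi, rfl⟩
      have h0 : 1 - height (u i₀) ≠ 0 := by linarith [hu i₀]
      have : a i = (1 - height (u i)) • emb (y i - y i₀) +
          ((1 - height (u i)) * (1 - height (u i₀))⁻¹) • a i₀ := by
        rw [ha i, ha i₀, smul_smul, mul_assoc, inv_mul_cancel₀ h0, mul_one, ← smul_add, map_sub]
        congr 1
        abel
      rw [SetLike.mem_coe, this]
      refine Submodule.add_mem_sup (Submodule.smul_mem _ _ (Submodule.mem_map_of_mem ?_))
        (Submodule.smul_mem _ _ (Submodule.mem_span_singleton_self _))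
      exact vsub_mem_vectorSpan ℝ (Set.mem_image_of_mem y hi) (Set.mem_image_of_mem y hi₀)
    · refine sup_le ?_ ?_
      · rw [vectorSpan_def, Submodule.map_span, Submodule.span_le]
        rintro _ ⟨_, ⟨_, ⟨i, hi, rfl⟩, _, ⟨j, hj, rfl⟩, rfl⟩, rfl⟩
        have := Submodule.sub_mem _ (hp i hi) (hp j hj)
        rw [sub_sub_sub_cancel_right] at this
        simpa using this
      · rw [Submodule.span_singleton_le_iff_mem]
        exact Submodule.subset_span ⟨i₀, hi₀, rfl⟩
  have hai₀ : height (a i₀) ≠ 0 := by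
    have : height (a i₀) = height (u i₀) - 1 := by
      simp only [a, height, map_sub, splitFirst_northPole]
      rfl
    rw [this]
    linarith [hu i₀]
  have hdisj : (vectorSpan ℝ (y '' J)).map emb ⊓ Submodule.span ℝ {a i₀} = ⊥ := by
    rw [eq_bot_iff]
    rintro x ⟨⟨w, -, rfl⟩, hx⟩
    obtain ⟨c, hc⟩ := Submodule.mem_span_singleton.1 hx
    have h := congrArg height hc
    rw [hheight] at h
    have h' : c * height (a i₀) = 0 := by
      rw [← h]
      simp [height]
    rw [(mul_eq_zero.1 h').resolve_right hai₀, zero_smul] at hc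
    exact hc.symm
  have hne : a i₀ ≠ 0 := fun h => hai₀ (by rw [h]; simp [height])
  have := Submodule.finrank_sup_add_finrank_inf_eq ((vectorSpan ℝ (y '' J)).map emb)
    (Submodule.span ℝ {a i₀})
  rwa [hdisj, finrank_bot, add_zero, finrank_span_singleton hne,
    (Submodule.equivMapOfInjective emb hemb _).finrank_eq.symm, ← hspan] at this

theorem faceCount_normalCone_sub_northPole [Finite ι] {u : ι → EuclideanSpace ℝ (Fin (d + 1))}
    (hu : ∀ i, height (u i) < 1) {k : ℕ} (hk : k < d) :
    faceCount (k + 1) (normalCone fun i => u i - northPole d) =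
      faceCount (d - k - 1) (convexHull ℝ (Set.range fun i => stereo (u i))) := by
  rw [faceCount_normalCone, faceCount_convexHull_range]
  congr 1
  ext J
  simp only [Set.mem_ofPred_eq]
  rw [isTightSet_sub_northPole_iff hu]
  have h := (Submodule.span ℝ ((fun i => u i - northPole d) '' J)).finrank_add_finrank_orthogonal
  rw [finrank_euclideanSpace_fin] at h
  rcases J.eq_empty_or_nonempty with rfl | hJ
  -- An empty tight set gives the whole cone, of dimension `d + 1`, which `k < d` rules out.
  · have hbot : Submodule.span ℝ ((fun i => u i - northPole d) '' ∅) = ⊥ := by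
      rw [Set.image_empty, Submodule.span_empty]
    rw [hbot, finrank_bot] at h
    rw [hbot]
    simp only [Set.not_nonempty_empty, false_and, iff_false, not_and]
    intro _
    omega
  · rw [finrank_span_sub_northPole hu hJ] at h
    simp only [hJ, true_and]
    refine and_congr_right fun _ => ?_
    omega

end Duality

end SphericalVoronoi

end

noncomputable section

namespace SphericalVoronoi

/-! ### The law of the stereographic projection of a uniform point -/

section Stereographic

open scoped Pointwise

variable {d : ℕ}

/-- The factor `(1 + ‖w‖²)⁻¹` occurring in the inverse stereographic projection. -/
def invOneAddSq (w : EuclideanSpace ℝ (Fin d)) : ℝ := (1 + ‖w‖ ^ 2)⁻¹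

lemma invOneAddSq_pos (w : EuclideanSpace ℝ (Fin d)) : 0 < invOneAddSq w := by
  unfold invOneAddSq
  positivity

lemma invOneAddSq_mul (w : EuclideanSpace ℝ (Fin d)) : invOneAddSq w * (1 + ‖w‖ ^ 2) = 1 :=
  inv_mul_cancel₀ (by positivity)

lemma measurable_invOneAddSq : Measurable (invOneAddSq (d := d)) := by
  unfold invOneAddSq
  fun_prop

/-- The coordinates of a vector as a pair. -/
def splitPair (x : EuclideanSpace ℝ (Fin (d + 1))) : ℝ × EuclideanSpace ℝ (Fin d) :=
  WithLp.ofLp (splitFirst d x)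

/-- The inverse stereographic projection. -/
def stereoInv (w : EuclideanSpace ℝ (Fin d)) : EuclideanSpace ℝ (Fin (d + 1)) :=
  (splitFirst d).symm (WithLp.toLp 2 (1 - 2 * invOneAddSq w, (2 * invOneAddSq w) • w))

/-- Polar coordinates with the sphere parametrized by the inverse stereographic projection. -/
def polarStereo (p : ℝ × EuclideanSpace ℝ (Fin d)) : ℝ × EuclideanSpace ℝ (Fin d) :=
  (p.1 * (1 - 2 * invOneAddSq p.2), (2 * p.1 * invOneAddSq p.2) • p.2)

lemma splitPair_injective : Function.Injective (splitPair (d := d)) :=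
  (WithLp.ofLp_injective 2).comp (splitFirst d).injective

lemma measurePreserving_splitPair : MeasurePreserving (splitPair (d := d)) volume volume :=
  (WithLp.volume_preserving_ofLp ℝ (EuclideanSpace ℝ (Fin d))).comp
    (splitFirst d).measurePreserving

lemma height_stereoInv (w : EuclideanSpace ℝ (Fin d)) :
    height (stereoInv w) = 1 - 2 * invOneAddSq w := by
  simp [height, stereoInv]

lemma tail_stereoInv (w : EuclideanSpace ℝ (Fin d)) :
    tail (stereoInv w) = (2 * invOneAddSq w) • w := by
  simp [tail, stereoInv]

lemma norm_stereoInv (w : EuclideanSpace ℝ (Fin d)) : ‖stereoInv w‖ = 1 := by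
  have h : ‖stereoInv w‖ ^ 2 = 1 := by
    rw [norm_sq_eq_height_sq_add, height_stereoInv, tail_stereoInv, norm_smul, mul_pow,
      Real.norm_eq_abs, sq_abs]
    linear_combination 4 * invOneAddSq w * invOneAddSq_mul w
  exact (pow_eq_one_iff_of_nonneg (norm_nonneg _) two_ne_zero).1 h

lemma stereo_stereoInv (w : EuclideanSpace ℝ (Fin d)) : stereo (stereoInv w) = w := by
  have := (invOneAddSq_pos w).ne'
  rw [stereo, height_stereoInv, tail_stereoInv, smul_smul, sub_sub_cancel,
    inv_mul_cancel₀ (by positivity), one_smul]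

lemma height_stereoInv_lt_one (w : EuclideanSpace ℝ (Fin d)) : height (stereoInv w) < 1 := by
  rw [height_stereoInv]
  linarith [invOneAddSq_pos w]

lemma stereoInv_stereo {x : EuclideanSpace ℝ (Fin (d + 1))} (hx : ‖x‖ = 1) (h : height x < 1) :
    stereoInv (stereo x) = x := by
  have h1 := norm_sq_eq_height_sq_add x
  have h0 : 1 - height x ≠ 0 := by linarith
  have h2 : invOneAddSq (stereo x) = (1 - height x) / 2 := by
    have h3 : ‖tail x‖ ^ 2 = (1 - height x) * (1 + height x) := by
      rw [hx] at h1
      linarith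
    rw [invOneAddSq, stereo, norm_smul, mul_pow, h3, Real.norm_eq_abs, sq_abs]
    field_simp
    ring
  apply (splitFirst d).injective
  apply (WithLp.ofLp_injective 2)
  refine Prod.ext ?_ ?_
  · change height _ = height _
    rw [height_stereoInv, h2]
    ring
  · change tail _ = tail _
    rw [tail_stereoInv, h2, stereo, smul_smul, mul_div_cancel₀ _ two_ne_zero, mul_inv_cancel₀ h0,
      one_smul]

lemma splitPair_smul_stereoInv (t : ℝ) (w : EuclideanSpace ℝ (Fin d)) :
    splitPair (t • stereoInv w) = polarStereo (t, w) := by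
  simp [splitPair, stereoInv, polarStereo, smul_smul]
  ring_nf

lemma injOn_polarStereo : Set.InjOn (polarStereo (d := d)) (Set.Ioo 0 1 ×ˢ Set.univ) := by
  rintro ⟨t, w⟩ ⟨⟨ht, -⟩, -⟩ ⟨t', w'⟩ ⟨⟨ht', -⟩, -⟩ h
  rw [← splitPair_smul_stereoInv, ← splitPair_smul_stereoInv] at h
  have h1 := splitPair_injective h
  have h2 := congrArg norm h1
  simp only [norm_smul, norm_stereoInv, mul_one, Real.norm_eq_abs, abs_of_pos ht,
    abs_of_pos ht'] at h2
  subst h2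
  have h3 := congrArg stereo (smul_right_injective _ ht.ne' h1)
  rw [stereo_stereoInv, stereo_stereoInv] at h3
  rw [h3]

/-- Shrinking the second factor by `r` turns `M` into an isometry of the Euclidean norm, whose
determinant is `±1`; no matrix is expanded. -/
lemma abs_det_eq_pow_of_sq_add_norm_sq {M : (ℝ × EuclideanSpace ℝ (Fin d)) →L[ℝ]
    (ℝ × EuclideanSpace ℝ (Fin d))} {r : ℝ} (hr : 0 < r)
    (hM : ∀ v, (M v).1 ^ 2 + ‖(M v).2‖ ^ 2 = v.1 ^ 2 + r ^ 2 * ‖v.2‖ ^ 2) : |M.det| = r ^ d := by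
  let e := WithLp.linearEquiv 2 ℝ (ℝ × EuclideanSpace ℝ (Fin d))
  let D : (ℝ × EuclideanSpace ℝ (Fin d)) →ₗ[ℝ] (ℝ × EuclideanSpace ℝ (Fin d)) :=
    LinearMap.prodMap LinearMap.id (r⁻¹ • LinearMap.id)
  have hD : LinearMap.det D = r⁻¹ ^ d := by
    rw [LinearMap.det_prodMap, LinearMap.det_smul]
    simp
  let N : WithLp 2 (ℝ × EuclideanSpace ℝ (Fin d)) →ₗᵢ[ℝ] WithLp 2 (ℝ × EuclideanSpace ℝ (Fin d)) :=
    { toLinearMap := e.symm.toLinearMap ∘ₗ (M.toLinearMap ∘ₗ D) ∘ₗ e.symm.symm.toLinearMap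
      norm_map' := fun v => by
        rw [← sq_eq_sq₀ (norm_nonneg _) (norm_nonneg _), WithLp.prod_norm_sq_eq_of_L2,
          WithLp.prod_norm_sq_eq_of_L2]
        have := hM (D (e v))
        simp only [Real.norm_eq_abs, sq_abs]
        refine this.trans ?_
        simp [D, e, norm_smul, mul_pow, hr.ne'] }
  have hN := N.normDet_eq_one
  rw [LinearMap.normDet_eq_abs_det, LinearMap.det_conj, LinearMap.det_comp, hD, abs_mul, inv_pow,
    abs_inv, abs_of_pos (pow_pos hr d)] at hN
  have hpos := (pow_pos hr d).ne'
  change |M.det| * _ = 1 at hN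
  field_simp at hN
  exact hN

/-- The derivative of `polarStereo`. -/
def polarStereoDeriv (p : ℝ × EuclideanSpace ℝ (Fin d)) :
    (ℝ × EuclideanSpace ℝ (Fin d)) →L[ℝ] (ℝ × EuclideanSpace ℝ (Fin d)) := fderiv ℝ polarStereo p

lemma hasFDerivAt_invOneAddSq_snd (p : ℝ × EuclideanSpace ℝ (Fin d)) :
    HasFDerivAt (fun q : ℝ × EuclideanSpace ℝ (Fin d) => invOneAddSq q.2)
      ((-(invOneAddSq p.2) ^ 2) • ((2 : ℝ) • (innerSL ℝ p.2).comp
        (ContinuousLinearMap.snd ℝ ℝ (EuclideanSpace ℝ (Fin d))))) p := by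
  have h1 : HasFDerivAt (fun q : ℝ × EuclideanSpace ℝ (Fin d) => 1 + ‖q.2‖ ^ 2) _ p :=
    (hasFDerivAt_snd (𝕜 := ℝ)).norm_sq.const_add 1
  have h2 := (hasDerivAt_inv (x := 1 + ‖p.2‖ ^ 2) (by positivity)).comp_hasFDerivAt p h1
  refine h2.congr_fderiv ?_
  ext <;> simp [invOneAddSq]

lemma hasFDerivAt_polarStereo (p : ℝ × EuclideanSpace ℝ (Fin d)) :
    HasFDerivAt polarStereo (polarStereoDeriv p) p ∧ ∀ v, polarStereoDeriv p v =
      (v.1 - (2 * invOneAddSq p.2 * v.1 - 4 * p.1 * invOneAddSq p.2 ^ 2 * inner ℝ p.2 v.2),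
        (2 * invOneAddSq p.2 * v.1 - 4 * p.1 * invOneAddSq p.2 ^ 2 * inner ℝ p.2 v.2) • p.2 +
          (2 * p.1 * invOneAddSq p.2) • v.2) := by
  have hρ := hasFDerivAt_invOneAddSq_snd p
  have h1 := (hasFDerivAt_fst (𝕜 := ℝ) (p := p)).mul ((hρ.const_mul 2).const_sub 1)
  have h2 := (((hasFDerivAt_fst (𝕜 := ℝ) (p := p)).const_mul 2).mul hρ).smul
    (hasFDerivAt_snd (𝕜 := ℝ) (p := p))
  have h : HasFDerivAt polarStereo _ p := h1.prodMk h2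
  rw [polarStereoDeriv, h.fderiv]
  refine ⟨h, fun v => Prod.ext ?_ ?_⟩
  · simp
    ring
  · simp
    rw [add_comm]
    congr 2
    ring

/-- Inverse stereographic projection is conformal with factor `2 * invOneAddSq`, and the radial
direction is orthogonal to the sphere. -/
lemma abs_det_polarStereoDeriv {p : ℝ × EuclideanSpace ℝ (Fin d)} (hp : 0 < p.1) :
    |(polarStereoDeriv p).det| = p.1 ^ d * (2 ^ d * invOneAddSq p.2 ^ d) := by
  have hρ := invOneAddSq_pos p.2
  rw [abs_det_eq_pow_of_sq_add_norm_sq (r := 2 * p.1 * invOneAddSq p.2) (by positivity)]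
  · ring
  · intro v
    rw [(hasFDerivAt_polarStereo p).2]
    simp only
    rw [norm_add_sq_real, norm_smul, norm_smul, mul_pow, mul_pow, Real.norm_eq_abs, sq_abs,
      Real.norm_eq_abs, sq_abs, inner_smul_left, inner_smul_right]
    simp only [conj_trivial]
    linear_combination (2 * invOneAddSq p.2 * v.1 -
      4 * p.1 * invOneAddSq p.2 ^ 2 * inner ℝ p.2 v.2) * (2 * v.1 - 4 * p.1 * invOneAddSq p.2 *
        inner ℝ p.2 v.2) * invOneAddSq_mul p.2

lemma volume_image_polarStereo {B : Set (EuclideanSpace ℝ (Fin d))} (hB : MeasurableSet B) :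
    volume (polarStereo '' (Set.Ioo 0 1 ×ˢ B)) =
      (∫⁻ t in Set.Ioo (0 : ℝ) 1, ENNReal.ofReal (t ^ d)) * ENNReal.ofReal (2 ^ d) *
        ∫⁻ w in B, ENNReal.ofReal (invOneAddSq w ^ d) := by
  have hS : MeasurableSet (Set.Ioo (0 : ℝ) 1 ×ˢ B) := measurableSet_Ioo.prod hB
  have : (volume : Measure (ℝ × EuclideanSpace ℝ (Fin d))).IsAddHaarMeasure := by
    rw [Measure.volume_eq_prod]
    infer_instance
  have h1 := lintegral_image_eq_lintegral_abs_det_fderiv_mul volume hS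
    (fun p _ => (hasFDerivAt_polarStereo p).1.hasFDerivWithinAt)
    (injOn_polarStereo.mono (Set.prod_mono_right (Set.subset_univ B))) 1
  simp only [Pi.one_apply, lintegral_one, Measure.restrict_apply_univ, mul_one] at h1
  rw [h1, setLIntegral_congr_fun (g := fun p => ENNReal.ofReal (p.1 ^ d) *
    (ENNReal.ofReal (2 ^ d) * ENNReal.ofReal (invOneAddSq p.2 ^ d))) hS]
  · rw [Measure.volume_eq_prod, ← Measure.prod_restrict,
      lintegral_prod_mul (f := fun t : ℝ => ENNReal.ofReal (t ^ d))
        (g := fun w => ENNReal.ofReal (2 ^ d) * ENNReal.ofReal (invOneAddSq w ^ d)),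
      lintegral_const_mul]
    · rw [mul_assoc]
    · exact (measurable_invOneAddSq.pow_const d).ennreal_ofReal
    · fun_prop
    · exact ((measurable_invOneAddSq.pow_const d).ennreal_ofReal.const_mul _).aemeasurable
  · rintro p ⟨hp, -⟩
    simp only
    rw [abs_det_polarStereoDeriv hp.1, ENNReal.ofReal_mul (pow_nonneg hp.1.le d),
      ENNReal.ofReal_mul (by positivity)]

/-- `toSphere` measures a subset of the sphere by the volume of the cone over it; here that cone is
put in polar stereographic coordinates. -/
lemma Ioo_smul_eq_preimage_polarStereo
    (Q : EuclideanSpace ℝ (Fin (d + 1)) ≃ₗᵢ[ℝ] EuclideanSpace ℝ (Fin (d + 1)))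
    (B : Set (EuclideanSpace ℝ (Fin d))) :
    {z | ∃ t ∈ Set.Ioo (0 : ℝ) 1, ∃ u : UnitSphere d, (height (Q u) < 1 ∧ stereo (Q u) ∈ B) ∧
      t • (u : EuclideanSpace ℝ (Fin (d + 1))) = z} =
      (fun z => splitPair (Q z)) ⁻¹' (polarStereo '' (Set.Ioo 0 1 ×ˢ B)) := by
  ext z
  constructor
  · rintro ⟨t, ht, u, ⟨hu, huB⟩, rfl⟩
    refine ⟨(t, stereo (Q u)), ⟨ht, huB⟩, ?_⟩
    rw [← splitPair_smul_stereoInv, stereoInv_stereo (by simp) hu]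
    simp
  · rintro ⟨⟨t, w⟩, ⟨ht, hw⟩, h⟩
    rw [← splitPair_smul_stereoInv] at h
    have h' := splitPair_injective h
    refine ⟨t, ht, ⟨Q.symm (stereoInv w), by simp [norm_stereoInv]⟩, ?_, ?_⟩
    · simp only [LinearIsometryEquiv.apply_symm_apply, stereo_stereoInv]
      exact ⟨height_stereoInv_lt_one w, hw⟩
    · apply Q.injective
      rw [← h']
      simp

lemma measurable_height : Measurable (height (d := d)) := by
  have : Measurable (fun x : EuclideanSpace ℝ (Fin (d + 1)) => x 0) := by fun_prop
  exact this

lemma measurable_stereo : Measurable (stereo (d := d)) := by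
  have h : Measurable (tail (d := d)) :=
    measurable_snd.comp (measurePreserving_splitPair (d := d)).measurable
  exact (measurable_const.sub measurable_height).inv.smul h

lemma measurable_stereo_comp
    (Q : EuclideanSpace ℝ (Fin (d + 1)) ≃ₗᵢ[ℝ] EuclideanSpace ℝ (Fin (d + 1))) :
    Measurable fun u : UnitSphere d => stereo (Q u) :=
  measurable_stereo.comp (Q.continuous.measurable.comp measurable_subtype_coe)

instance isProbabilityMeasure_sphereUniform : IsProbabilityMeasure (sphereUniform d) where
  measure_univ := by
    rw [sphereUniform, Measure.smul_apply, smul_eq_mul]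
    refine ENNReal.inv_mul_cancel ?_ (measure_ne_top _ _)
    rw [Ne, Measure.measure_univ_eq_zero]
    exact Measure.toSphere_ne_zero _

lemma sphereUniform_singleton (hd : 1 ≤ d) (v : UnitSphere d) : sphereUniform d {v} = 0 := by
  rw [sphereUniform, Measure.smul_apply, Measure.toSphere_apply' _ (measurableSet_singleton v)]
  have : volume (Set.Ioo (0 : ℝ) 1 • ((↑) '' ({v} : Set (UnitSphere d)) :
      Set (EuclideanSpace ℝ (Fin (d + 1))))) = 0 := by
    refine measure_mono_null (t := (Submodule.span ℝ {(v : EuclideanSpace ℝ (Fin (d + 1)))} :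
      Set (EuclideanSpace ℝ (Fin (d + 1))))) ?_ (Measure.addHaar_submodule _ _ ?_)
    · rw [Set.image_singleton]
      rintro _ ⟨t, -, _, rfl, rfl⟩
      exact Submodule.smul_mem _ _ (Submodule.mem_span_singleton_self _)
    · intro htop
      have h1 := finrank_span_le_card (R := ℝ) ({(v : EuclideanSpace ℝ (Fin (d + 1)))} : Set _)
      rw [htop, finrank_top, finrank_euclideanSpace_fin] at h1
      simp at h1
      omega
  rw [this]
  simp

/-- The constant in front of the integral is left unevaluated. It depends on neither `B` nor `Q`,
which is all that is needed. -/
lemma sphereUniform_preimage_stereo (hd : 1 ≤ d)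
    (Q : EuclideanSpace ℝ (Fin (d + 1)) ≃ₗᵢ[ℝ] EuclideanSpace ℝ (Fin (d + 1)))
    {B : Set (EuclideanSpace ℝ (Fin d))} (hB : MeasurableSet B) :
    sphereUniform d ((fun u : UnitSphere d => stereo (Q u)) ⁻¹' B) =
      ((volume : Measure (EuclideanSpace ℝ (Fin (d + 1)))).toSphere Set.univ)⁻¹ * ((d + 1 : ℕ) *
        ((∫⁻ t in Set.Ioo (0 : ℝ) 1, ENNReal.ofReal (t ^ d)) * ENNReal.ofReal (2 ^ d))) *
        ∫⁻ w in B, ENNReal.ofReal (invOneAddSq w ^ d) := by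
  set S : Set (UnitSphere d) := {u | height (Q u) < 1 ∧ stereo (Q u) ∈ B}
  have hS : MeasurableSet S :=
    (measurableSet_lt (measurable_height.comp (Q.continuous.measurable.comp measurable_subtype_coe))
      measurable_const).inter (measurable_stereo_comp Q hB)
  -- At the pole `stereo` takes the default value `0`; that single point is null.
  have hae : ((fun u : UnitSphere d => stereo (Q u)) ⁻¹' B) =ᵐ[sphereUniform d] S := by
    have h0 : ∀ᵐ u ∂(sphereUniform d), u ≠ (⟨Q.symm (northPole d), by simp [northPole]⟩ :
        UnitSphere d) := by
      rw [ae_iff]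
      simpa using sphereUniform_singleton hd _
    filter_upwards [h0] with u hu
    have hlt : height (Q u) < 1 := height_lt_one (by simp) fun h => hu (by
      ext1
      simp [← h])
    exact propext ⟨fun h => ⟨hlt, h⟩, fun h => h.2⟩
  rw [measure_congr hae, sphereUniform, Measure.smul_apply, Measure.toSphere_apply' _ hS,
    finrank_euclideanSpace_fin, smul_eq_mul, mul_assoc, mul_assoc (Nat.cast _)]
  congr 2
  rw [← volume_image_polarStereo hB]
  have himage : MeasurableSet (polarStereo '' (Set.Ioo (0 : ℝ) 1 ×ˢ B)) :=
    measurable_image_of_fderivWithin (measurableSet_Ioo.prod hB)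
      (fun p _ => (hasFDerivAt_polarStereo p).1.hasFDerivWithinAt)
      (injOn_polarStereo.mono (Set.prod_mono_right (Set.subset_univ B)))
  rw [← (measurePreserving_splitPair.comp Q.measurePreserving).measure_preimage
    himage.nullMeasurableSet]
  congr 1
  refine Eq.trans ?_ (Ioo_smul_eq_preimage_polarStereo Q B)
  ext z
  simp only [Set.mem_smul, Set.mem_image, exists_exists_and_eq_and]
  rfl

lemma betaPrimeMeasure_apply {B : Set (EuclideanSpace ℝ (Fin d))} (hB : MeasurableSet B) :
    betaPrimeMeasure d d B = ENNReal.ofReal (Real.Gamma d /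
      (Real.pi ^ ((d : ℝ) / 2) * Real.Gamma ((d : ℝ) - (d : ℝ) / 2))) *
        ∫⁻ w in B, ENNReal.ofReal (invOneAddSq w ^ d) := by
  rw [betaPrimeMeasure, withDensity_apply _ hB,
    ← lintegral_const_mul _ (measurable_invOneAddSq.pow_const d).ennreal_ofReal]
  refine lintegral_congr fun w => ?_
  rw [← ENNReal.ofReal_mul' (pow_nonneg (invOneAddSq_pos w).le d), betaPrimeDensity,
    Real.rpow_neg (by positivity), Real.rpow_natCast, invOneAddSq, inv_pow]

/-- The stereographic projection of a uniform point of the sphere has a beta' distribution. -/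
theorem measurePreserving_stereo [IsProbabilityMeasure (betaPrimeMeasure d d)] (hd : 1 ≤ d)
    (Q : EuclideanSpace ℝ (Fin (d + 1)) ≃ₗᵢ[ℝ] EuclideanSpace ℝ (Fin (d + 1))) :
    MeasurePreserving (fun u : UnitSphere d => stereo (Q u)) (sphereUniform d)
      (betaPrimeMeasure d d) := by
  refine ⟨measurable_stereo_comp Q, Measure.ext fun B hB => ?_⟩
  have h1 : sphereUniform d Set.univ = 1 := measure_univ
  have h2 : betaPrimeMeasure d d Set.univ = 1 := measure_univ
  rw [← Set.preimage_univ (f := fun u : UnitSphere d => stereo (Q u)),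
    sphereUniform_preimage_stereo hd Q .univ] at h1
  rw [betaPrimeMeasure_apply .univ] at h2
  rw [Measure.map_apply (measurable_stereo_comp Q) hB, sphereUniform_preimage_stereo hd Q hB,
    betaPrimeMeasure_apply hB]
  congr 1
  -- Both laws are multiples of one measure and have total mass `1`, so the multiples agree.
  rw [← mul_one (_ * (_ * _)), ← h2, mul_left_comm, h1, mul_one]

end Stereographic

end SphericalVoronoi

end

noncomputable section

namespace SphericalVoronoi

/-! ### The typical cell -/

section TypicalCell

variable {d n : ℕ}

lemma angle_le_angle_iff {E : Type*} [NormedAddCommGroup E] [InnerProductSpace ℝ E] {x y z : E}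
    (hx : ‖x‖ = 1) (hy : ‖y‖ = 1) (hz : ‖z‖ = 1) :
    InnerProductGeometry.angle x z ≤ InnerProductGeometry.angle y z ↔
      inner ℝ y z ≤ inner ℝ x z := by
  have hmem : ∀ {w : E}, ‖w‖ = 1 → inner ℝ w z ∈ Set.Icc (-1 : ℝ) 1 := fun {w} hw => by
    have := abs_real_inner_le_norm w z
    rw [hw, hz, one_mul] at this
    exact abs_le.1 this
  simp only [InnerProductGeometry.angle, hx, hy, hz, mul_one, div_one]
  exact Real.strictAntiOn_arccos.le_iff_ge (hmem hx) (hmem hy)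

/-- On unit vectors a smaller angle is a larger inner product. The constraint of the nucleus against
itself is trivial and drops out through `succAbove`. -/
lemma rotatedCell_eq
    {O : UnitSphere d → (EuclideanSpace ℝ (Fin (d + 1)) ≃ₗᵢ[ℝ] EuclideanSpace ℝ (Fin (d + 1)))}
    (hO : ∀ v, O v (v : EuclideanSpace ℝ (Fin (d + 1))) = northPole d)
    (x : Fin (n + 1) → UnitSphere d) (i : Fin (n + 1)) :
    rotatedCell O x i = normalCone (fun j : Fin n => O (x i) (x (i.succAbove j)) - northPole d) ∩
      Metric.sphere 0 1 := by
  ext z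
  rw [rotatedCell, (O (x i)).image_eq_preimage_symm, Set.mem_preimage, Set.inter_comm]
  have hsphere : (O (x i)).symm z ∈ Metric.sphere (0 : EuclideanSpace ℝ (Fin (d + 1))) 1 ↔
      z ∈ Metric.sphere (0 : EuclideanSpace ℝ (Fin (d + 1))) 1 := by simp
  rw [voronoiCell, Set.mem_ofPred_eq, hsphere, Set.mem_inter_iff]
  refine and_congr_right fun hz => ?_
  have hz' : ‖(O (x i)).symm z‖ = 1 := by simpa using hz
  have h : ∀ j, InnerProductGeometry.angle (x i : EuclideanSpace ℝ (Fin (d + 1))) ((O (x i)).symm z)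
      ≤ InnerProductGeometry.angle (x j : EuclideanSpace ℝ (Fin (d + 1))) ((O (x i)).symm z) ↔
      inner ℝ (O (x i) (x j) - northPole d) z ≤ 0 := fun j => by
    rw [angle_le_angle_iff (by simp) (by simp) hz', ← (O (x i)).inner_map_map,
      ← (O (x i)).inner_map_map (x i : EuclideanSpace ℝ (Fin (d + 1))), hO,
      LinearIsometryEquiv.apply_symm_apply, inner_sub_left, sub_nonpos]
  rw [i.forall_iff_succAbove, and_iff_right le_rfl]
  exact forall_congr' fun j => h _

/-- The stereographic projections of the points other than the `i`-th one, after moving the `i`-th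
point to the north pole. -/
def projectOthers
    (O : UnitSphere d → (EuclideanSpace ℝ (Fin (d + 1)) ≃ₗᵢ[ℝ] EuclideanSpace ℝ (Fin (d + 1))))
    (i : Fin (n + 1)) (x : Fin (n + 1) → UnitSphere d) : Fin n → EuclideanSpace ℝ (Fin d) :=
  fun j => stereo (O (x i) (x (i.succAbove j)))

theorem sphericalFaceCount_rotatedCell
    {O : UnitSphere d → (EuclideanSpace ℝ (Fin (d + 1)) ≃ₗᵢ[ℝ] EuclideanSpace ℝ (Fin (d + 1)))}
    (hO : ∀ v, O v (v : EuclideanSpace ℝ (Fin (d + 1))) = northPole d)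
    {x : Fin (n + 1) → UnitSphere d} (hx : Function.Injective x) (i : Fin (n + 1))
    {k : ℕ} (hk : k < d) :
    sphericalFaceCount k (rotatedCell O x i) =
      faceCount (d - k - 1) (convexHull ℝ (Set.range (projectOthers O i x))) := by
  rw [rotatedCell_eq hO, sphericalFaceCount_normalCone, faceCount_normalCone_sub_northPole _ hk]
  · rfl
  · intro j
    refine height_lt_one (by simp) fun h => ?_
    rw [← hO (x i)] at h
    exact Fin.succAbove_ne i j (hx (Subtype.ext ((O (x i)).injective h)))

lemma measurable_uncurry_rotation
    {O : UnitSphere d → (EuclideanSpace ℝ (Fin (d + 1)) ≃ₗᵢ[ℝ] EuclideanSpace ℝ (Fin (d + 1)))}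
    (hO : ∀ i j : Fin (d + 1),
      Measurable fun v => (O v (EuclideanSpace.single j (1 : ℝ))) i) :
    Measurable fun p : UnitSphere d × UnitSphere d =>
      O p.1 (p.2 : EuclideanSpace ℝ (Fin (d + 1))) := by
  have h : ∀ (v : UnitSphere d) (u : EuclideanSpace ℝ (Fin (d + 1))) (i : Fin (d + 1)),
      O v u i = ∑ j, u j * (O v (EuclideanSpace.single j (1 : ℝ))) i := fun v u i => by
    have hu : u = ∑ j, u j • EuclideanSpace.single j (1 : ℝ) := by
      ext i
      simp [Pi.single_apply]
    conv_lhs => rw [hu]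
    simp
  refine (MeasurableEquiv.toLp 2 (Fin (d + 1) → ℝ)).symm.measurableEmbedding.measurable_comp_iff.1 ?_
  refine measurable_pi_iff.2 fun i => ?_
  suffices Measurable fun p : UnitSphere d × UnitSphere d =>
      ∑ j, (p.2 : EuclideanSpace ℝ (Fin (d + 1))) j * (O p.1 (EuclideanSpace.single j (1 : ℝ))) i by
    convert! this using 2 with p
    exact h p.1 p.2 i
  refine Finset.measurable_sum _ fun j _ => Measurable.mul ?_ ((hO i j).comp measurable_fst)
  fun_prop

/-- For each fixed value `v` of the nucleus the image law is the same beta' product, so the skew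
product over `v` is a product measure. -/
theorem measurePreserving_projectOthers [IsProbabilityMeasure (betaPrimeMeasure d d)] (hd : 1 ≤ d)
    {O : UnitSphere d → (EuclideanSpace ℝ (Fin (d + 1)) ≃ₗᵢ[ℝ] EuclideanSpace ℝ (Fin (d + 1)))}
    (hO : ∀ i j : Fin (d + 1),
      Measurable fun v => (O v (EuclideanSpace.single j (1 : ℝ))) i) (i : Fin (n + 1)) :
    MeasurePreserving (projectOthers O i) (Measure.pi fun _ => sphereUniform d)
      (Measure.pi fun _ => betaPrimeMeasure d d) := by
  have h1 := measurePreserving_piFinSuccAbove (fun _ : Fin (n + 1) => sphereUniform d) i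
  let g : UnitSphere d → (Fin n → UnitSphere d) → (Fin n → EuclideanSpace ℝ (Fin d)) :=
    fun v u j => stereo (O v (u j))
  have hg : Measurable (Function.uncurry g) := by
    refine measurable_pi_iff.2 fun j => measurable_stereo.comp ?_
    exact (measurable_uncurry_rotation hO).comp
      (f := fun p : UnitSphere d × (Fin n → UnitSphere d) => (p.1, p.2 j)) (by fun_prop)
  have h2 := (MeasurePreserving.id (sphereUniform d)).skew_product (g := g)
    (μc := Measure.pi fun _ => sphereUniform d) (μd := Measure.pi fun _ => betaPrimeMeasure d d) hg
    (Filter.Eventually.of_forall fun v =>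
      (measurePreserving_pi _ _ fun _ => measurePreserving_stereo hd (O v)).map_eq)
  exact measurePreserving_snd.comp (h2.comp h1)

theorem hasLaw_projectOthers [IsProbabilityMeasure (betaPrimeMeasure d d)] (hd : 1 ≤ d)
    {O : UnitSphere d → (EuclideanSpace ℝ (Fin (d + 1)) ≃ₗᵢ[ℝ] EuclideanSpace ℝ (Fin (d + 1)))}
    (hO : ∀ i j : Fin (d + 1),
      Measurable fun v => (O v (EuclideanSpace.single j (1 : ℝ))) i)
    {Ω : Type*} [MeasurableSpace Ω] {P : Measure Ω} [IsProbabilityMeasure P]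
    {X : Ω → Fin (n + 1) → UnitSphere d} {N : Ω → Fin (n + 1)}
    (hX : HasLaw X (Measure.pi fun _ => sphereUniform d) P) (hN : AEMeasurable N P)
    (hNX : IndepFun N X P) :
    HasLaw (fun ω => projectOthers O (N ω) (X ω)) (Measure.pi fun _ => betaPrimeMeasure d d) P := by
  have h1 : HasLaw (fun ω => (N ω, X ω))
      ((P.map N).prod (Measure.pi fun _ => sphereUniform d)) P :=
    ⟨hN.prodMk hX.aemeasurable, by
      rw [hNX.map_prod_eq_prod_map_map hN hX.aemeasurable, hX.map_eq]⟩
  have : IsProbabilityMeasure (P.map N) := Measure.isProbabilityMeasure_map hN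
  have hmeas : Measurable (Function.uncurry (projectOthers (n := n) O)) :=
    measurable_from_prod_countable_right fun i =>
      (measurePreserving_projectOthers hd hO i).measurable
  have h2 := (MeasurePreserving.id (P.map N)).skew_product (g := projectOthers O)
    (μc := Measure.pi fun _ => sphereUniform d) (μd := Measure.pi fun _ => betaPrimeMeasure d d)
    hmeas (Filter.Eventually.of_forall fun i => (measurePreserving_projectOthers hd hO i).map_eq)
  exact (measurePreserving_snd.comp h2).fun_comp_hasLaw h1

/-- By Fubini the diagonal is null, since points are. This keeps the other points off the pole after
rotation. -/
lemma ae_injective_of_iIndepFun (hd : 1 ≤ d) {ι Ω : Type*} [Finite ι] [MeasurableSpace Ω]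
    {P : Measure Ω} [IsProbabilityMeasure P] {X : ι → Ω → UnitSphere d}
    (hX : ∀ i, HasLaw (X i) (sphereUniform d) P) (hXindep : iIndepFun X P) :
    ∀ᵐ ω ∂P, Function.Injective fun i => X i ω := by
  have h : ∀ i j, i ≠ j → ∀ᵐ ω ∂P, X i ω ≠ X j ω := fun i j hij => by
    have hlaw : HasLaw (fun ω => (X i ω, X j ω)) ((sphereUniform d).prod (sphereUniform d)) P :=
      ⟨(hX i).aemeasurable.prodMk (hX j).aemeasurable, by
        rw [(hXindep.indepFun hij).map_prod_eq_prod_map_map (hX i).aemeasurable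
          (hX j).aemeasurable, (hX i).map_eq, (hX j).map_eq]⟩
    have hdiag : MeasurableSet {p : UnitSphere d × UnitSphere d | p.1 = p.2} :=
      measurableSet_eq_fun measurable_fst measurable_snd
    have h0 : (sphereUniform d).prod (sphereUniform d)
        {p : UnitSphere d × UnitSphere d | p.1 = p.2} = 0 := by
      rw [Measure.measure_prod_null hdiag]
      refine Filter.Eventually.of_forall fun v => ?_
      have : Prod.mk v ⁻¹' {p : UnitSphere d × UnitSphere d | p.1 = p.2} = {v} := by
        ext u
        simp [eq_comm]
      simpa [this] using sphereUniform_singleton hd v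
    rw [← hlaw.map_eq, Measure.map_apply_of_aemeasurable hlaw.aemeasurable hdiag] at h0
    rw [ae_iff]
    simpa using h0
  have h' : ∀ᵐ ω ∂P, ∀ i j, i ≠ j → X i ω ≠ X j ω := by
    rw [ae_all_iff]
    intro i
    rw [ae_all_iff]
    intro j
    by_cases hij : i = j
    · simp [hij]
    · simpa [hij] using h i j hij
  filter_upwards [h'] with ω hω i j hij
  by_contra hne
  exact hω i j hne hij

end TypicalCell

end SphericalVoronoi

end

/-! ### Equality in distribution of the face vectors -/

theorem theorem2p3 (d n : ℕ) (hd : 1 ≤ d) (hn : d + 1 ≤ n)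
    -- a Borel family of orthogonal transformations taking `v` to the north pole
    (O : SphericalVoronoi.UnitSphere d →
      (EuclideanSpace ℝ (Fin (d + 1)) ≃ₗᵢ[ℝ] EuclideanSpace ℝ (Fin (d + 1))))
    (hO : ∀ v, O v (v : EuclideanSpace ℝ (Fin (d + 1))) = SphericalVoronoi.northPole d)
    (hOmeas : ∀ i j : Fin (d + 1),
      Measurable fun v => (O v (EuclideanSpace.single j (1 : ℝ))) i)
    -- `n + 1` i.i.d. uniform points on the sphere and an independent uniform index
    {Ω : Type*} [MeasurableSpace Ω] (P : Measure Ω) [IsProbabilityMeasure P]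
    (X : Fin (n + 1) → Ω → SphericalVoronoi.UnitSphere d) (N : Ω → Fin (n + 1))
    (hX : ∀ i, HasLaw (X i) (SphericalVoronoi.sphereUniform d) P)
    (hXindep : iIndepFun X P)
    (hN : HasLaw N (uniformOn (Set.univ : Set (Fin (n + 1)))) P)
    (hNX : IndepFun N (fun ω i => X i ω) P)
    -- `n` i.i.d. points with the beta' distribution of parameter `β = d`
    {Ω' : Type*} [MeasurableSpace Ω'] (P' : Measure Ω') [IsProbabilityMeasure P']
    (Y : Fin n → Ω' → EuclideanSpace ℝ (Fin d))
    (hY : ∀ i, HasLaw (Y i) (SphericalVoronoi.betaPrimeMeasure d d) P')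
    (hYindep : iIndepFun Y P') :
    IdentDistrib
      (fun ω (k : Fin d) => SphericalVoronoi.sphericalFaceCount (k : ℕ)
        (SphericalVoronoi.rotatedCell O (fun i => X i ω) (N ω)))
      (fun ω' (k : Fin d) => SphericalVoronoi.faceCount (d - (k : ℕ) - 1)
        (convexHull ℝ (Set.range fun i => Y i ω')))
      P P' := by
  -- The beta' normalization is read off from the law of one `Y i`, with no Gamma integral computed.
  have hβ : IsProbabilityMeasure (SphericalVoronoi.betaPrimeMeasure d d) := by
    have hY0 := hY ⟨0, by omega⟩
    rw [← hY0.map_eq]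
    exact Measure.isProbabilityMeasure_map hY0.aemeasurable
  have hT := SphericalVoronoi.hasLaw_projectOthers hd hOmeas (hXindep.hasLaw_pi hX)
    hN.aemeasurable hNX
  have hYlaw := hYindep.hasLaw_pi hY
  let H : (Fin n → EuclideanSpace ℝ (Fin d)) → Fin d → ℕ := fun y k =>
    SphericalVoronoi.faceCount (d - (k : ℕ) - 1) (convexHull ℝ (Set.range y))
  have hH : Measurable H := measurable_pi_iff.2 fun k =>
    SphericalVoronoi.measurable_faceCount_convexHull_range _
  have hident : IdentDistrib
      (fun ω => SphericalVoronoi.projectOthers O (N ω) fun i => X i ω) (fun ω' i => Y i ω') P P' :=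
    ⟨hT.aemeasurable, hYlaw.aemeasurable, hT.map_eq.trans hYlaw.map_eq.symm⟩
  have hcomp := hident.comp hH
  refine (IdentDistrib.of_ae_eq ?_ ?_).trans hcomp
  -- Measurability of the cell's face vector is inherited from the hull's, with which it agrees
  -- almost surely.
  · refine hcomp.aemeasurable_fst.congr ?_
    filter_upwards [SphericalVoronoi.ae_injective_of_iIndepFun hd hX hXindep] with ω hω
    funext k
    exact (SphericalVoronoi.sphericalFaceCount_rotatedCell hO hω (N ω) k.isLt).symm
  · filter_upwards [SphericalVoronoi.ae_injective_of_iIndepFun hd hX hXindep] with ω hω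
    funext k
    exact SphericalVoronoi.sphericalFaceCount_rotatedCell hO hω (N ω) k.isLt
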